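/- Let $R,l\ge 0$ be integers, let $\mathcal T=(t_{ijk})\in\mathbb R^{I\times J\times R}$, and let $\mathcal T=[\mathbf A,\mathbf B,\mathbf C]_R$, i.e. $t_{ijk}=\sum_{r=1}^R a_{ir}b_{jr}c_{kr}$ with $\mathbf A\in\mathbb R^{I\times R}$, $\mathbf B\in\mathbb R^{J\times R}$ and $\mathbf C\in\mathbb R^{R\times R}$ of rank $R$; if $R=1$, assume also $\mathcal T\neq 0$. Index the coordinates of $\mathbb R^{R^{n}}$ by tuples $(k_1,\dots,k_n)\in\{1,\dots,R\}^n$, and let $S^{n}(\mathbb R^{R^{n}})$ be the span of the vectors $\mathbf x\otimes\dots\otimes\mathbf x$ ($n$ factors), $\mathbf x\in\mathbb R^R$. Let $\mathbf R_{2,l}(\mathcal T)\in\mathbb R^{I^{2+l}J^{2+l}\times R^{2+l}}$ be the matrix whose entry in row $((i_1,\dots,i_{2+l}),(j_1,\dots,j_{2+l}))$ and column $(k_1,\dots,k_{2+l})$ is $$\frac1{2!\,(2+l)!}\sum_{\sigma}\det\begin{bmatrix}t_{i_1j_1s_1}&t_{i_1j_2s_2}\\ t_{i_2j_1s_1}&t_{i_2j_2s_2}\end{bmatrix}\prod_{p=1}^{l}t_{i_{2+p}j_{2+p}s_{2+p}},\qquad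 s_p=k_{\sigma(p)},$$ the sum being over all $(2+l)!$ permutations $\sigma$ of $\{1,\dots,2+l\}$. Assume $$\dim\left(\ker\mathbf R_{2,l}(\mathcal T)\cap S^{2+l}(\mathbb R^{R^{2+l}})\right)=R.$$ Then: (1) The rank of $\mathcal T$ (the least number of rank-1 tensors with sum $\mathcal T$) is $R$, and the canonical polyadic decomposition (CPD, a decomposition into $R$ = rank terms) of $\mathcal T$ is unique up to a permutation of the terms and scalings of the vectors within each term whose product is $1$. (2) The CPD can be found algebraically by the following algorithm. The space $\ker\mathbf R_{2,l}(\mathcal T)\cap S^{2+l}(\mathbb R^{R^{2+l}})$ has a basis of $R$ vectors; let $\mathbf w_1,\dots,\mathbf w_R$ be any such basis, and reshape $[\mathbf w_1\ \dots\ \mathbf w_R]$ into an $R\times R^{1+l}\times R$ tensor $\mathcal W$ with frontal slices $\mathbf W_1,\dots,\mathbf W_R\in\mathbb R^{R\times R^{1+l}}$. Below, $\odot$ is the Khatri-Rao (columnwise Kronecker) product. (a) $\mathcal W$ has rank $R$ and its CPD is unique. (b) For $\mathbf x,\mathbf y\in\mathbb R^R$ put $\mathbf P=\sum_r x_r\mathbf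 W_r$, $\mathbf Q=\sum_r y_r\mathbf W_r$. A generalized eigenvalue decomposition (GEVD) of $(\mathbf P,\mathbf Q)$, where $\mathbf Q$ has rank $R$, is a nonsingular $\mathbf Z\in\mathbb R^{R\times R}$ and distinct real $d_1,\dots,d_R$ with $\mathbf z_r^T\mathbf P=d_r\mathbf z_r^T\mathbf Q$ for every column $\mathbf z_r$ of $\mathbf Z$. For generic $(\mathbf x,\mathbf y)$ (wherever some nonzero real polynomial in $(\mathbf x,\mathbf y)$ does not vanish) $\mathbf Q$ has rank $R$ and a GEVD exists. Whenever $\mathbf Q$ has rank $R$ and $(\mathbf Z,d)$ is a GEVD, $\mathbf F=\mathbf Z^{-T}$ satisfies $\mathcal W=[\mathbf F,\mathbf F\odot\dots\odot\mathbf F,\mathbf M]_R$ ($1+l$ factors $\mathbf F$ in the Khatri-Rao product) for some nonsingular $\mathbf M\in\mathbb R^{R\times R}$, and this is the CPD of $\mathcal W$. (c) For every CPD of $\mathcal W$ of the form $[\mathbf F,\mathbf F\odot\dots\odot\mathbf F,\mathbf M]_R$, the matrix $\mathbf F$ is nonsingular. Let $\mathbf R_{1,0}(\mathcal T)\in\mathbb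 R^{IJ\times R}$ have entries $t_{ijk}$ (row $(i,j)$, column $k$). Each column of $\mathbf R_{1,0}(\mathcal T)\mathbf F$ is a vectorized $I\times J$ matrix of rank $1$; the equation $\mathbf A'\odot\mathbf B'=\mathbf R_{1,0}(\mathcal T)\mathbf F$ has a solution $\mathbf A'\in\mathbb R^{I\times R}$, $\mathbf B'\in\mathbb R^{J\times R}$; and for every solution $\mathcal T=[\mathbf A',\mathbf B',\mathbf F^{-T}]_R$ is the CPD of $\mathcal T$. -/

import Mathlib

noncomputable section

namespace CPD

open scoped BigOperators

/-- The third-order tensor `[A, B, C]_R`, i.e. the sum over `r` of the outer products of the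
`r`-th columns of `A`, `B`, `C`. -/
def cp {ι κ μ : Type*} {R : ℕ} (A : Matrix ι (Fin R) ℝ) (B : Matrix κ (Fin R) ℝ)
    (C : Matrix μ (Fin R) ℝ) : ι → κ → μ → ℝ :=
  fun i j k => ∑ r, A i r * B j r * C k r

/-- `T` is a sum of `n` rank-1 tensors (outer products of three nonzero vectors). -/
def IsSumOfRankOne {ι κ μ : Type*} (T : ι → κ → μ → ℝ) (n : ℕ) : Prop :=
  ∃ (A : Matrix ι (Fin n) ℝ) (B : Matrix κ (Fin n) ℝ) (C : Matrix μ (Fin n) ℝ),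
    (∀ r, A.col r ≠ 0 ∧ B.col r ≠ 0 ∧ C.col r ≠ 0) ∧ T = cp A B C

/-- The rank of `T` is `R`: the least number of rank-1 tensors that sum up to `T`. -/
def HasTensorRank {ι κ μ : Type*} (T : ι → κ → μ → ℝ) (R : ℕ) : Prop :=
  IsLeast {n : ℕ | IsSumOfRankOne T n} R

/-- `T = [A, B, C]_R` is a canonical polyadic decomposition: the number `R` of terms equals the
rank of `T`. -/
def IsCPD {ι κ μ : Type*} {R : ℕ} (T : ι → κ → μ → ℝ) (A : Matrix ι (Fin R) ℝ)
    (B : Matrix κ (Fin R) ℝ) (C : Matrix μ (Fin R) ℝ) : Prop :=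
  T = cp A B C ∧ HasTensorRank T R

/-- Any two CPDs of `T` with `R` terms coincide up to a permutation of the rank-1 terms and a
scaling of the vectors within each term that leaves the term unchanged. -/
def UniqueCPD {ι κ μ : Type*} (T : ι → κ → μ → ℝ) (R : ℕ) : Prop :=
  ∀ (A A' : Matrix ι (Fin R) ℝ) (B B' : Matrix κ (Fin R) ℝ) (C C' : Matrix μ (Fin R) ℝ),
    IsCPD T A B C → IsCPD T A' B' C' →
    ∃ (σ : Equiv.Perm (Fin R)) (α β γ : Fin R → ℝ),
      (∀ r, α r * β r * γ r = 1) ∧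
      (∀ i r, A' i r = α r * A i (σ r)) ∧
      (∀ j r, B' j r = β r * B j (σ r)) ∧
      (∀ k r, C' k r = γ r * C k (σ r))

/-- The matrix `R_{m,l}(T)`. Its rows are indexed by the pairs of tuples
`((i_1,…,i_{m+l}), (j_1,…,j_{m+l}))` and its columns by the tuples `(k_1,…,k_{m+l})`. The sum over
the permutations of `(k_1,…,k_{m+l})` counts multiplicities, i.e. it has `(m+l)!` terms. -/
def symMinorMatrix {I J K : ℕ} (m l : ℕ) (T : Fin I → Fin J → Fin K → ℝ) :
    Matrix ((Fin (m + l) → Fin I) × (Fin (m + l) → Fin J)) (Fin (m + l) → Fin K) ℝ :=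
  Matrix.of fun ij k =>
    1 / ((m.factorial : ℝ) * ((m + l).factorial : ℝ)) *
      ∑ σ : Equiv.Perm (Fin (m + l)),
        (Matrix.of fun p q : Fin m =>
            T (ij.1 (Fin.castAdd l p)) (ij.2 (Fin.castAdd l q)) (k (σ (Fin.castAdd l q)))).det *
          ∏ p : Fin l,
            T (ij.1 (Fin.natAdd m p)) (ij.2 (Fin.natAdd m p)) (k (σ (Fin.natAdd m p)))

/-- The space `S^n(ℝ^{K^n})` spanned by the vectors `x ⊗ ⋯ ⊗ x` (`n` factors), `x ∈ ℝ^K`, where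
the coordinates of `ℝ^{K^n}` are indexed by the tuples `(k_1,…,k_n)`. -/
def symSpace (n K : ℕ) : Submodule ℝ ((Fin n → Fin K) → ℝ) :=
  Submodule.span ℝ (Set.range fun (x : Fin K → ℝ) (k : Fin n → Fin K) => ∏ p, x (k p))

/-- The space `ker (R_{2,l}(T)) ∩ S^{2+l}(ℝ^{K^{2+l}})`. -/
def symKer {I J K : ℕ} (l : ℕ) (T : Fin I → Fin J → Fin K → ℝ) :
    Submodule ℝ ((Fin (2 + l) → Fin K) → ℝ) :=
  LinearMap.ker (symMinorMatrix 2 l T).mulVecLin ⊓ symSpace (2 + l) K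

/-- The Khatri-Rao product `A ⊙ B` (columnwise Kronecker product). -/
def khatriRao {ι κ ρ : Type*} (A : Matrix ι ρ ℝ) (B : Matrix κ ρ ℝ) : Matrix (ι × κ) ρ ℝ :=
  Matrix.of fun ij r => A ij.1 r * B ij.2 r

/-- The Khatri-Rao power `F ⊙ ⋯ ⊙ F` (`n` factors). -/
def khatriRaoPow {κ ρ : Type*} (F : Matrix κ ρ ℝ) (n : ℕ) : Matrix (Fin n → κ) ρ ℝ :=
  Matrix.of fun k r => ∏ p, F (k p) r

/-- The matrix `R_{1,0}(T)`: the horizontal slices of `T` stacked on top of each other. -/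
def unfold {ι κ μ : Type*} (T : ι → κ → μ → ℝ) : Matrix (ι × κ) μ ℝ :=
  Matrix.of fun ij k => T ij.1 ij.2 k

/-- The vectors `w_1,…,w_R` form a basis of `ker (R_{2,l}(T)) ∩ S^{2+l}(ℝ^{R^{2+l}})`. -/
def IsNullBasis {I J R : ℕ} (l : ℕ) (T : Fin I → Fin J → Fin R → ℝ)
    (w : Fin R → (Fin (2 + l) → Fin R) → ℝ) : Prop :=
  LinearIndependent ℝ w ∧ Submodule.span ℝ (Set.range w) = symKer l T

/-- The `R × R^{1+l} × R` tensor obtained by reshaping the matrix `[w_1 ⋯ w_R]`. -/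
def reshape {R l : ℕ} (w : Fin R → (Fin (2 + l) → Fin R) → ℝ) :
    Fin R → (Fin (1 + l) → Fin R) → Fin R → ℝ :=
  fun k κ r => w r fun p => (Fin.cons k κ : Fin ((1 + l) + 1) → Fin R) (Fin.cast (by omega) p)

/-- The linear combination of the frontal slices of `W` with coefficients `x`. -/
def sliceComb {ι κ : Type*} {R : ℕ} (W : ι → κ → Fin R → ℝ) (x : Fin R → ℝ) : Matrix ι κ ℝ :=
  Matrix.of fun i j => ∑ r, x r * W i j r

/-- `(Z, d)` is a generalized eigenvalue decomposition of the pencil `(P, Q)` with `Q` of full row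
rank: the columns `z_r` of the nonsingular matrix `Z` satisfy `z_rᵀ P = d_r z_rᵀ Q`, and the
generalized eigenvalues `d_r` are distinct. -/
def IsGEVD {κ : Type*} [Fintype κ] {R : ℕ} (P Q : Matrix (Fin R) κ ℝ)
    (Z : Matrix (Fin R) (Fin R) ℝ) (d : Fin R → ℝ) : Prop :=
  Q.rank = R ∧ IsUnit Z.det ∧ Function.Injective d ∧
    Z.transpose * P = Matrix.diagonal d * (Z.transpose * Q)

end CPD

end

/-! Let `F` be the inverse transpose of `C`, with columns `f_r`. Contracting `T` with `f_r` leaves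
`a_r b_rᵀ`, so the tensor powers of the `f_r` lie in the kernel (`prod_mem_symKer`). They are
independent, being dual to the powers of the `c_r`, and the dimension hypothesis makes them span it
(`symKer_cp_eq_span`). Now if `∑ g_r a_r b_rᵀ` has rank at most one, the power of `F g` is in this
span. The functional `c_s ⊗ c_t ⊗ ⋯ ⊗ c_t` kills the span, hence `g_s g_t = 0`
(`onlyTrivialRankOne_of_finrank_symKer`). Rank and uniqueness follow: two CPDs differ by a
nonsingular change of basis whose columns have a single nonzero entry.

For the algorithm, any kernel basis reshapes to `[F, F ⊙ ⋯ ⊙ F, M]_R` with `M` nonsingular. Here the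
first two factors have left inverses, so the same uniqueness argument applies. The slice pencils are
simultaneously diagonalized by `F`, so a GEVD returns `F` up to permuted and rescaled columns, and
multiplying the unfolding of `T` by it isolates the rank-one terms. -/

namespace CPD

open Matrix

/-! ### Scaled permutations and outer products -/

/-- A nonsingular matrix whose columns have at most one nonzero entry is a scaled permutation
matrix. -/
theorem exists_perm_of_isUnit_det {R : ℕ} (G : Matrix (Fin R) (Fin R) ℝ) (hG : IsUnit G.det)
    (h : ∀ r s t, s ≠ t → G s r * G t r = 0) :
    ∃ (σ : Equiv.Perm (Fin R)) (δ : Fin R → ℝ), (∀ r, δ r ≠ 0) ∧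
      ∀ i r, G i r = if i = σ r then δ r else 0 := by
  have hcol : ∀ r, ∃ i, G i r ≠ 0 := by
    intro r
    by_contra! hc
    exact hG.ne_zero (Matrix.det_eq_zero_of_column_eq_zero r hc)
  choose τ hτ using hcol
  have hz : ∀ i r, i ≠ τ r → G i r = 0 := fun i r hi =>
    (mul_eq_zero.mp (h r i (τ r) hi)).resolve_right (hτ r)
  have hsurj : Function.Surjective τ := by
    intro i
    by_contra! hc
    exact hG.ne_zero (Matrix.det_eq_zero_of_row_eq_zero i fun r => hz i r (hc r).symm)
  refine ⟨Equiv.ofBijective τ (Finite.surjective_iff_bijective.mp hsurj), fun r => G (τ r) r, hτ,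
    fun i r => ?_⟩
  rw [Equiv.ofBijective_apply]
  split_ifs with hi
  · rw [hi]
  · exact hz i r hi

/-- Permuting and rescaling the columns of a nonsingular matrix keeps it nonsingular. -/
theorem isUnit_det_of_perm_scale {R : ℕ} {F G : Matrix (Fin R) (Fin R) ℝ} (hF : IsUnit F.det)
    (σ : Equiv.Perm (Fin R)) (δ : Fin R → ℝ) (hδ : ∀ r, δ r ≠ 0)
    (h : ∀ i r, G i r = δ r * F i (σ r)) : IsUnit G.det := by
  have hG : G = F.submatrix id σ * Matrix.diagonal δ := by
    ext i r
    rw [Matrix.mul_diagonal, h, Matrix.submatrix_apply, id, mul_comm]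
  rw [hG, Matrix.det_mul, Matrix.det_permute', Matrix.det_diagonal]
  refine isUnit_iff_ne_zero.mpr (mul_ne_zero (mul_ne_zero ?_ hF.ne_zero)
    (Finset.prod_ne_zero_iff.mpr fun r _ => hδ r))
  rcases Int.units_eq_one_or (Equiv.Perm.sign σ) with h1 | h1 <;> simp [h1]

/-- Proportional nonzero outer products have proportional factors. -/
theorem exists_scale_of_outer_eq {ι κ : Type*} {a u : ι → ℝ} {b v : κ → ℝ} {δ : ℝ} (hδ : δ ≠ 0)
    (ha : a ≠ 0) (hb : b ≠ 0) (h : ∀ i j, u i * v j = δ * (a i * b j)) :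
    ∃ α β : ℝ, α * β = δ ∧ (∀ i, u i = α * a i) ∧ ∀ j, v j = β * b j := by
  obtain ⟨i₀, hi⟩ := Function.ne_iff.mp ha
  obtain ⟨j₀, hj⟩ := Function.ne_iff.mp hb
  simp only [Pi.zero_apply] at hi hj
  have h0 : u i₀ * v j₀ ≠ 0 := by
    rw [h]
    exact mul_ne_zero hδ (mul_ne_zero hi hj)
  have hu : u i₀ ≠ 0 := left_ne_zero_of_mul h0
  have hv : v j₀ ≠ 0 := right_ne_zero_of_mul h0
  refine ⟨δ * b j₀ / v j₀, v j₀ / b j₀, by field_simp, fun i => ?_, fun j => ?_⟩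
  · have := h i j₀
    field_simp
    linarith
  · have h1 := h i₀ j
    have h2 := h i₀ j₀
    field_simp
    have : u i₀ * (v j * b j₀) = u i₀ * (v j₀ * b j) := by
      linear_combination b j₀ * h1 - b j * h2
    exact mul_left_cancel₀ hu this

/-! ### Rank and uniqueness with a nonsingular third factor -/

/-- The only matrices of rank at most one in the span of the matrices `a_r b_rᵀ` are the multiples
of these matrices. -/
def OnlyTrivialRankOne {ι κ : Type*} {R : ℕ} (A : Matrix ι (Fin R) ℝ) (B : Matrix κ (Fin R) ℝ) :
    Prop :=
  ∀ (g : Fin R → ℝ) (u : ι → ℝ) (v : κ → ℝ), (∀ i j, ∑ r, A i r * B j r * g r = u i * v j) →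
    ∀ s t, s ≠ t → g s * g t = 0

theorem unfold_cp {ι κ μ : Type*} {n : ℕ} (A : Matrix ι (Fin n) ℝ) (B : Matrix κ (Fin n) ℝ)
    (C : Matrix μ (Fin n) ℝ) : unfold (cp A B C) = khatriRao A B * Cᵀ := by
  ext ij k
  simp [unfold, cp, khatriRao, Matrix.mul_apply]

theorem unfold_injective {ι κ μ : Type*} {T T' : ι → κ → μ → ℝ} (h : unfold T = unfold T') :
    T = T' := by
  funext i j k
  exact congrFun (congrFun h (i, j)) k

theorem khatriRao_col_ne_zero {ι κ : Type*} {R : ℕ} {A : Matrix ι (Fin R) ℝ}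
    {B : Matrix κ (Fin R) ℝ} (h : Function.Injective (khatriRao A B).mulVec) (r : Fin R) :
    A.col r ≠ 0 ∧ B.col r ≠ 0 := by
  have key : ¬ ∀ i j, A i r * B j r = 0 := by
    intro h0
    have : (Pi.single r 1 : Fin R → ℝ) = 0 := by
      apply h
      ext ij
      simpa [khatriRao] using h0 ij.1 ij.2
    simpa using congrFun this r
  constructor <;> intro hz <;> refine key fun i j => ?_
  · rw [show A i r = 0 from congrFun hz i, zero_mul]
  · rw [show B j r = 0 from congrFun hz j, mul_zero]

/-- Cancelling `Cᵀ` in the equality of unfoldings factors the injective `A ⊙ B` through this matrix.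
Injectivity yields the lower bound on the rank and, for `R` terms, the nonsingularity of `C'`. -/
theorem injective_transpose_mul_of_cp_eq {ι κ : Type*} {R n : ℕ} {A : Matrix ι (Fin R) ℝ}
    {B : Matrix κ (Fin R) ℝ} {C : Matrix (Fin R) (Fin R) ℝ} (hC : IsUnit C.det)
    (hAB : Function.Injective (khatriRao A B).mulVec) {A' : Matrix ι (Fin n) ℝ}
    {B' : Matrix κ (Fin n) ℝ} {C' : Matrix (Fin R) (Fin n) ℝ} (h : cp A B C = cp A' B' C') :
    Function.Injective (C'ᵀ * (Cᵀ)⁻¹).mulVec := by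
  have hCt : IsUnit (Cᵀ).det := by rwa [Matrix.det_transpose]
  have h1 : khatriRao A B = khatriRao A' B' * (C'ᵀ * (Cᵀ)⁻¹) := by
    rw [← Matrix.mul_assoc, ← unfold_cp, ← h, unfold_cp, Matrix.mul_assoc,
      Matrix.mul_nonsing_inv _ hCt, Matrix.mul_one]
  intro x y hxy
  apply hAB
  have := congrArg (khatriRao A' B').mulVec hxy
  rwa [Matrix.mulVec_mulVec, Matrix.mulVec_mulVec, ← h1] at this

theorem hasTensorRank_cp {ι κ : Type*} {R : ℕ} {A : Matrix ι (Fin R) ℝ} {B : Matrix κ (Fin R) ℝ}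
    {C : Matrix (Fin R) (Fin R) ℝ} (hC : IsUnit C.det)
    (hAB : Function.Injective (khatriRao A B).mulVec) : HasTensorRank (cp A B C) R := by
  refine ⟨⟨A, B, C, fun r => ⟨(khatriRao_col_ne_zero hAB r).1, (khatriRao_col_ne_zero hAB r).2,
    fun hz => hC.ne_zero (Matrix.det_eq_zero_of_column_eq_zero r (congrFun hz))⟩, rfl⟩, ?_⟩
  rintro n ⟨A', B', C', -, h⟩
  have hinj := injective_transpose_mul_of_cp_eq hC hAB h
  have := LinearMap.finrank_le_finrank_of_injective
    (f := (C'ᵀ * (Cᵀ)⁻¹).mulVecLin) hinj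
  simpa using this

theorem exists_perm_scale_of_cp_eq {ι κ : Type*} {R : ℕ} {A A' : Matrix ι (Fin R) ℝ}
    {B B' : Matrix κ (Fin R) ℝ} {C C' : Matrix (Fin R) (Fin R) ℝ} (hC : IsUnit C.det)
    (hAB : Function.Injective (khatriRao A B).mulVec) (hone : OnlyTrivialRankOne A B)
    (h : cp A B C = cp A' B' C') :
    ∃ (σ : Equiv.Perm (Fin R)) (α β γ : Fin R → ℝ),
      (∀ r, α r * β r * γ r = 1) ∧
      (∀ i r, A' i r = α r * A i (σ r)) ∧
      (∀ j r, B' j r = β r * B j (σ r)) ∧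
      (∀ k r, C' k r = γ r * C k (σ r)) := by
  have hinj := injective_transpose_mul_of_cp_eq hC hAB h
  rw [Matrix.mulVec_injective_iff_isUnit, Matrix.isUnit_iff_isUnit_det, Matrix.det_mul] at hinj
  have hC' : IsUnit (C'ᵀ).det := isUnit_of_mul_isUnit_left hinj
  have hCt : IsUnit (Cᵀ).det := by rwa [Matrix.det_transpose]
  have hG : khatriRao A' B' = khatriRao A B * (Cᵀ * (C'ᵀ)⁻¹) := by
    rw [← Matrix.mul_assoc, ← unfold_cp, h, unfold_cp, Matrix.mul_assoc,
      Matrix.mul_nonsing_inv _ hC', Matrix.mul_one]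
  have hGC : Cᵀ * (C'ᵀ)⁻¹ * C'ᵀ = Cᵀ := by
    rw [Matrix.mul_assoc, Matrix.nonsing_inv_mul _ hC', Matrix.mul_one]
  have hGu : IsUnit (Cᵀ * (C'ᵀ)⁻¹).det := by
    rw [Matrix.det_mul]
    exact hCt.mul (Matrix.isUnit_nonsing_inv_det _ hC')
  generalize Cᵀ * (C'ᵀ)⁻¹ = G at hG hGC hGu
  -- Column `r` of `G` expands the rank-one matrix `a'_r b'_rᵀ` in the `a_s b_sᵀ`, so it has at most
  -- one nonzero entry.
  obtain ⟨σ, δ, hδ, hσ⟩ := exists_perm_of_isUnit_det G hGu fun r =>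
    hone (fun s => G s r) (fun i => A' i r) (fun j => B' j r) fun i j =>
      (congrFun (congrFun hG (i, j)) r).symm
  have hout : ∀ r i j, A' i r * B' j r = δ r * (A i (σ r) * B j (σ r)) := by
    intro r i j
    have := congrFun (congrFun hG (i, j)) r
    simp only [Matrix.mul_apply, hσ, khatriRao, Matrix.of_apply, mul_ite, mul_zero,
      Finset.sum_ite_eq', Finset.mem_univ, if_true] at this
    rw [this, mul_comm]
  have hCC : ∀ k r, C k (σ r) = δ r * C' k r := by
    intro k r
    have := congrFun (congrFun hGC (σ r)) k
    simpa [Matrix.mul_apply, hσ] using this.symm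
  choose α β hαβ hα hβ using fun r => exists_scale_of_outer_eq (hδ r)
    (khatriRao_col_ne_zero hAB (σ r)).1 (khatriRao_col_ne_zero hAB (σ r)).2 (hout r)
  refine ⟨σ, α, β, fun r => (δ r)⁻¹, fun r => ?_, fun i r => hα r i, fun j r => hβ r j,
    fun k r => ?_⟩
  · rw [hαβ, mul_inv_cancel₀ (hδ r)]
  · rw [hCC, inv_mul_cancel_left₀ (hδ r)]

theorem uniqueCPD_cp {ι κ : Type*} {R : ℕ} {A : Matrix ι (Fin R) ℝ} {B : Matrix κ (Fin R) ℝ}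
    {C : Matrix (Fin R) (Fin R) ℝ} (hC : IsUnit C.det)
    (hAB : Function.Injective (khatriRao A B).mulVec) (hone : OnlyTrivialRankOne A B) :
    UniqueCPD (cp A B C) R := by
  rintro A₁ A₂ B₁ B₂ C₁ C₂ ⟨h₁, -⟩ ⟨h₂, -⟩
  obtain ⟨σ₁, α₁, β₁, γ₁, hu₁, hA₁, hB₁, hC₁⟩ := exists_perm_scale_of_cp_eq hC hAB hone h₁
  obtain ⟨σ₂, α₂, β₂, γ₂, hu₂, hA₂, hB₂, hC₂⟩ := exists_perm_scale_of_cp_eq hC hAB hone h₂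
  have hne : ∀ r, α₁ r ≠ 0 ∧ β₁ r ≠ 0 ∧ γ₁ r ≠ 0 := by
    intro r
    have h0 : α₁ r * β₁ r * γ₁ r ≠ 0 := by simp [hu₁ r]
    exact ⟨left_ne_zero_of_mul (left_ne_zero_of_mul h0),
      right_ne_zero_of_mul (left_ne_zero_of_mul h0), right_ne_zero_of_mul h0⟩
  -- Both decompositions are compared with the reference one; the quotient of the two comparisons
  -- relates them to each other.
  refine ⟨σ₂.trans σ₁.symm, fun r => α₂ r / α₁ (σ₁.symm (σ₂ r)),
    fun r => β₂ r / β₁ (σ₁.symm (σ₂ r)), fun r => γ₂ r / γ₁ (σ₁.symm (σ₂ r)),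
    fun r => ?_, fun i r => ?_, fun i r => ?_, fun i r => ?_⟩
  · rw [div_mul_div_comm, div_mul_div_comm, hu₁, hu₂, div_one]
  · have := (hne (σ₁.symm (σ₂ r))).1
    rw [Equiv.trans_apply, hA₁, hA₂, Equiv.apply_symm_apply]
    field_simp
  · have := (hne (σ₁.symm (σ₂ r))).2.1
    rw [Equiv.trans_apply, hB₁, hB₂, Equiv.apply_symm_apply]
    field_simp
  · have := (hne (σ₁.symm (σ₂ r))).2.2
    rw [Equiv.trans_apply, hC₁, hC₂, Equiv.apply_symm_apply]
    field_simp

/-! ### Factors with left inverses -/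

/-- Matrices with full column rank have only trivial rank-one combinations. -/
theorem onlyTrivialRankOne_of_leftInverse {ι κ : Type*} [Fintype ι] [Fintype κ] {R : ℕ}
    {A : Matrix ι (Fin R) ℝ} {B : Matrix κ (Fin R) ℝ} {A' : Matrix (Fin R) ι ℝ}
    {B' : Matrix (Fin R) κ ℝ} (hA : A' * A = 1) (hB : B' * B = 1) : OnlyTrivialRankOne A B := by
  intro g u v h s t hst
  have h1 : A * Matrix.diagonal g * Bᵀ = Matrix.vecMulVec u v := by
    ext i j
    rw [Matrix.vecMulVec_apply, ← h, Matrix.mul_apply]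
    exact Finset.sum_congr rfl fun r _ => by
      rw [Matrix.mul_diagonal, Matrix.transpose_apply]
      ring
  have h2 : Matrix.diagonal g = Matrix.vecMulVec (A' *ᵥ u) (B' *ᵥ v) := by
    have hBt : Bᵀ * B'ᵀ = 1 := by rw [← Matrix.transpose_mul, hB, Matrix.transpose_one]
    calc Matrix.diagonal g = A' * (A * Matrix.diagonal g * Bᵀ) * B'ᵀ := by
          rw [Matrix.mul_assoc, Matrix.mul_assoc, hBt, Matrix.mul_one, ← Matrix.mul_assoc, hA,
            Matrix.one_mul]
      _ = _ := by
          rw [h1, Matrix.mul_vecMulVec, Matrix.vecMulVec_mul, Matrix.vecMul_transpose]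
  have e : ∀ p q, Matrix.diagonal g p q = (A' *ᵥ u) p * (B' *ᵥ v) q := fun p q => by
    rw [h2, Matrix.vecMulVec_apply]
  have ess := e s s
  have ett := e t t
  have est := e s t
  rw [Matrix.diagonal_apply_eq] at ess ett
  rw [Matrix.diagonal_apply_ne _ hst] at est
  rw [ess, ett]
  -- With `diagonal g = p qᵀ`, the product `g s * g t` contains the off-diagonal entry `p s * q t =
  -- 0`.
  linear_combination -((A' *ᵥ u) t * (B' *ᵥ v) s) * est

theorem khatriRao_injective_of_leftInverse {ι κ : Type*} [Fintype ι] [Fintype κ] {R : ℕ}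
    {A : Matrix ι (Fin R) ℝ} {B : Matrix κ (Fin R) ℝ} {A' : Matrix (Fin R) ι ℝ}
    {B' : Matrix (Fin R) κ ℝ} (hA : A' * A = 1) (hB : B' * B = 1) :
    Function.Injective (khatriRao A B).mulVec := by
  have h : (khatriRao A'ᵀ B'ᵀ)ᵀ * khatriRao A B = 1 := by
    ext r s
    have h1 : ∀ (i : ι) (j : κ), A' r i * B' r j * (A i s * B j s) =
        (A' r i * A i s) * (B' r j * B j s) := fun i j => by ring
    have hA' := congrFun (congrFun hA r) s
    have hB' := congrFun (congrFun hB r) s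
    rw [Matrix.mul_apply] at hA' hB'
    simp only [Matrix.mul_apply, khatriRao, Matrix.transpose_apply, Matrix.of_apply,
      Fintype.sum_prod_type, h1]
    rw [← Finset.sum_mul_sum, hA', hB', Matrix.one_apply]
    split_ifs <;> simp
  intro x y hxy
  simpa [Matrix.mulVec_mulVec, h] using congrArg ((khatriRao A'ᵀ B'ᵀ)ᵀ).mulVec hxy

/-! ### Tensor powers and the symmetric kernel -/

theorem sum_prod_eq_prod_sum {n K : ℕ} (f : Fin n → Fin K → ℝ) :
    ∑ k : Fin n → Fin K, ∏ p, f p (k p) = ∏ p, ∑ κ, f p κ := by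
  rw [Finset.prod_univ_sum, Fintype.piFinset_univ]

/-- Permuting the factors of a multilinear form does not change its value at `x ⊗ ⋯ ⊗ x`. -/
theorem sum_prod_perm_mul_prod {n K : ℕ} (f : Fin n → Fin K → ℝ) (x : Fin K → ℝ)
    (σ : Equiv.Perm (Fin n)) :
    ∑ k : Fin n → Fin K, (∏ p, f p (k (σ p))) * ∏ p, x (k p) = ∏ p, ∑ κ, f p κ * x κ := by
  rw [← sum_prod_eq_prod_sum, ← Equiv.sum_comp (σ.arrowCongr (Equiv.refl (Fin K)))]
  refine Finset.sum_congr rfl fun k _ => ?_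
  rw [Finset.prod_mul_distrib]
  congr 1
  · simp [Equiv.arrowCongr]
  · simpa [Equiv.arrowCongr] using Equiv.prod_comp σ.symm fun p => x (k p)

theorem khatriRaoPow_transpose_mul {K R : ℕ} (C F : Matrix (Fin K) (Fin R) ℝ) (n : ℕ)
    (r s : Fin R) :
    ((khatriRaoPow C n)ᵀ * khatriRaoPow F n) r s = ((Cᵀ * F) r s) ^ n := by
  simp only [Matrix.mul_apply, Matrix.transpose_apply, khatriRaoPow, Matrix.of_apply,
    ← Finset.prod_mul_distrib]
  rw [sum_prod_eq_prod_sum (fun _ κ => C κ r * F κ s), Finset.prod_const, Finset.card_univ,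
    Fintype.card_fin]

theorem khatriRaoPow_leftInverse {K R : ℕ} {C F : Matrix (Fin K) (Fin R) ℝ} {n : ℕ} (hn : n ≠ 0)
    (h : Cᵀ * F = 1) : (khatriRaoPow C n)ᵀ * khatriRaoPow F n = 1 := by
  ext r s
  rw [khatriRaoPow_transpose_mul, h, Matrix.one_apply]
  split_ifs <;> simp [hn]

/-- The two monomials of the minor differ by exchanging the first two row indices. This makes each a
product over all `2 + l` positions, to which `sum_prod_perm_mul_prod` applies. -/
theorem minor_mul_prod {ι κ μ : Type*} {l : ℕ} (T : ι → κ → μ → ℝ) (i : Fin (2 + l) → ι)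
    (j : Fin (2 + l) → κ) (k : Fin (2 + l) → μ) :
    (Matrix.of fun p q : Fin 2 =>
        T (i (Fin.castAdd l p)) (j (Fin.castAdd l q)) (k (Fin.castAdd l q))).det *
      ∏ p : Fin l, T (i (Fin.natAdd 2 p)) (j (Fin.natAdd 2 p)) (k (Fin.natAdd 2 p)) =
    (∏ p, T (i p) (j p) (k p)) -
      ∏ p, T (i (Equiv.swap (Fin.castAdd l 0) (Fin.castAdd l 1) p)) (j p) (k p) := by
  have h : ∀ p : Fin l, Equiv.swap (Fin.castAdd l (0 : Fin 2)) (Fin.castAdd l 1) (Fin.natAdd 2 p) =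
      Fin.natAdd 2 p := fun p =>
    Equiv.swap_apply_of_ne_of_ne (by simp [Fin.ext_iff]) (by simp [Fin.ext_iff]; omega)
  simp only [Fin.prod_univ_add, Fin.prod_univ_two, Matrix.det_fin_two, Matrix.of_apply, h,
    Equiv.swap_apply_left, Equiv.swap_apply_right]
  ring

/-- If the contraction of `T` with `x` has rank at most one, then `x ⊗ ⋯ ⊗ x` lies in the kernel. -/
theorem prod_mem_symKer {I J K l : ℕ} {T : Fin I → Fin J → Fin K → ℝ} {x : Fin K → ℝ}
    {u : Fin I → ℝ} {v : Fin J → ℝ} (h : ∀ i j, ∑ k, T i j k * x k = u i * v j) :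
    (fun k => ∏ p, x (k p)) ∈ symKer l T := by
  refine ⟨?_, Submodule.subset_span ⟨x, rfl⟩⟩
  rw [SetLike.mem_coe, LinearMap.mem_ker, Matrix.mulVecLin_apply]
  ext ⟨i, j⟩
  simp only [Matrix.mulVec, dotProduct, symMinorMatrix, Matrix.of_apply, Pi.zero_apply]
  simp only [mul_assoc, ← Finset.mul_sum, Finset.sum_mul]
  rw [Finset.sum_comm]
  refine mul_eq_zero_of_right _ (Finset.sum_eq_zero fun σ _ => ?_)
  have hm := fun k : Fin (2 + l) → Fin K => minor_mul_prod T i j fun p => k (σ p)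
  simp only [← mul_assoc, hm, sub_mul, Finset.sum_sub_distrib]
  rw [sum_prod_perm_mul_prod (fun p κ => T (i p) (j p) κ), sum_prod_perm_mul_prod
    (fun p κ => T (i (Equiv.swap (Fin.castAdd l 0) (Fin.castAdd l 1) p)) (j p) κ)]
  simp only [h, Finset.prod_mul_distrib]
  -- Both terms have become `∏ u · ∏ v`, and the swap only reorders the factors of `∏ u`.
  rw [Equiv.prod_comp (Equiv.swap (Fin.castAdd l 0) (Fin.castAdd l 1)) (fun p => u (i p)), sub_self]

theorem sum_cp_mul {ι κ : Type*} {K R : ℕ} (A : Matrix ι (Fin R) ℝ) (B : Matrix κ (Fin R) ℝ)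
    (C : Matrix (Fin K) (Fin R) ℝ) (x : Fin K → ℝ) (i : ι) (j : κ) :
    ∑ k, cp A B C i j k * x k = ∑ r, A i r * B j r * (Cᵀ *ᵥ x) r := by
  simp only [cp, Matrix.mulVec, dotProduct, Matrix.transpose_apply, Finset.sum_mul, Finset.mul_sum]
  rw [Finset.sum_comm]
  exact Finset.sum_congr rfl fun r _ => Finset.sum_congr rfl fun k _ => by ring

theorem linearIndependent_col_of_leftInverse {κ : Type*} [Fintype κ] {R : ℕ}
    {G : Matrix κ (Fin R) ℝ} {L : Matrix (Fin R) κ ℝ} (h : L * G = 1) :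
    LinearIndependent ℝ G.col := by
  rw [← Matrix.mulVec_injective_iff]
  intro x y hxy
  simpa [Matrix.mulVec_mulVec, h] using congrArg L.mulVec hxy

theorem symKer_cp_eq_span {I J R l : ℕ} {A : Matrix (Fin I) (Fin R) ℝ}
    {B : Matrix (Fin J) (Fin R) ℝ} {C F : Matrix (Fin R) (Fin R) ℝ} (hF : Cᵀ * F = 1)
    (hdim : Module.finrank ℝ (symKer l (cp A B C)) = R) :
    Submodule.span ℝ (Set.range (khatriRaoPow F (2 + l)).col) = symKer l (cp A B C) := by
  refine Submodule.eq_of_le_of_finrank_eq (Submodule.span_le.mpr ?_) ?_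
  · rintro _ ⟨r, rfl⟩
    refine prod_mem_symKer (u := fun i => A i r) (v := fun j => B j r) (x := F.col r) fun i j => ?_
    have h : ∀ s, (Cᵀ *ᵥ F.col r) s = (1 : Matrix (Fin R) (Fin R) ℝ) s r := fun s => by
      rw [← hF]
      rfl
    rw [sum_cp_mul]
    simp [h, Matrix.one_apply]
  · rw [finrank_span_eq_card (linearIndependent_col_of_leftInverse
      (khatriRaoPow_leftInverse (by omega) hF)), hdim, Fintype.card_fin]

theorem onlyTrivialRankOne_of_finrank_symKer {I J R l : ℕ} {A : Matrix (Fin I) (Fin R) ℝ}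
    {B : Matrix (Fin J) (Fin R) ℝ} {C F : Matrix (Fin R) (Fin R) ℝ} (hF : Cᵀ * F = 1)
    (hdim : Module.finrank ℝ (symKer l (cp A B C)) = R) : OnlyTrivialRankOne A B := by
  intro g u v h s t hst
  have hx : Cᵀ *ᵥ (F *ᵥ g) = g := by rw [Matrix.mulVec_mulVec, hF, Matrix.one_mulVec]
  have hmem : (fun k => ∏ p, (F *ᵥ g) (k p)) ∈ symKer l (cp A B C) :=
    prod_mem_symKer (u := u) (v := v) fun i j => by rw [sum_cp_mul, hx, h]
  rw [← symKer_cp_eq_span hF hdim] at hmem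
  -- Position `0` carries `s` and the remaining `1 + l ≥ 1` positions carry `t`, so each `f_r` is
  -- annihilated in at least one position.
  let c : Fin (2 + l) → Fin R := fun p => if p.val = 0 then s else t
  let φ : ((Fin (2 + l) → Fin R) → ℝ) →ₗ[ℝ] ℝ :=
    dotProductBilin ℝ ℝ fun k => ∏ p, C (k p) (c p)
  have hφ : ∀ y : Fin R → ℝ, φ (fun k => ∏ p, y (k p)) = ∏ p, (Cᵀ *ᵥ y) (c p) := by
    intro y
    change ∑ k : Fin (2 + l) → Fin R, (∏ p, C (k p) (c p)) * ∏ p, y (k p) = _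
    simp only [← Finset.prod_mul_distrib]
    exact sum_prod_eq_prod_sum fun p κ => C κ (c p) * y κ
  have hle : Submodule.span ℝ (Set.range (khatriRaoPow F (2 + l)).col) ≤ LinearMap.ker φ := by
    rw [Submodule.span_le]
    rintro _ ⟨r, rfl⟩
    have hr : ∀ q, (Cᵀ *ᵥ F.col r) q = (1 : Matrix (Fin R) (Fin R) ℝ) q r := fun q => by
      rw [← hF]
      rfl
    refine (hφ (F.col r)).trans ?_
    by_cases hrs : s = r
    · refine Finset.prod_eq_zero (Finset.mem_univ ⟨1, by omega⟩) ?_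
      rw [hr, Matrix.one_apply_ne]
      simpa [c, ← hrs] using hst.symm
    · refine Finset.prod_eq_zero (Finset.mem_univ ⟨0, by omega⟩) ?_
      rw [hr, Matrix.one_apply_ne]
      simpa [c] using hrs
  have h0 := hle hmem
  rw [LinearMap.mem_ker, hφ, hx, Finset.prod_eq_zero_iff] at h0
  obtain ⟨p, -, hp⟩ := h0
  simp only [c] at hp
  split_ifs at hp <;> simp [hp]

/-- A relation among the `a_r b_rᵀ` has at most one nonzero coefficient; adding it to a different
term gives a forbidden rank-one combination. This needs a second index, hence the separate
assumption for `R = 1`. -/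
theorem khatriRao_injective_of_onlyTrivialRankOne {ι κ : Type*} {R : ℕ} {A : Matrix ι (Fin R) ℝ}
    {B : Matrix κ (Fin R) ℝ} (h : OnlyTrivialRankOne A B)
    (h1 : R = 1 → khatriRao A B ≠ 0) : Function.Injective (khatriRao A B).mulVec := by
  refine (injective_iff_map_eq_zero (khatriRao A B).mulVecLin).mpr fun g hg => ?_
  have hg' : ∀ i j, ∑ r, A i r * B j r * g r = 0 := fun i j => congrFun hg (i, j)
  by_contra hne
  obtain ⟨s, hs⟩ := Function.ne_iff.mp hne
  rw [Pi.zero_apply] at hs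
  by_cases hR : ∃ t, t ≠ s
  · obtain ⟨t, ht⟩ := hR
    have hgt : g t = 0 := by
      -- The zero matrix counts as an outer product.
      have := h g 0 0 (fun i j => by rw [hg']; simp) s t ht.symm
      exact (mul_eq_zero.mp this).resolve_left hs
    have := h (g + Pi.single t 1) (fun i => A i t) (fun j => B j t) (fun i j => by
      simp [mul_add, Finset.sum_add_distrib, hg', Pi.single_apply]) s t ht.symm
    simp [hgt, ht.symm, hs] at this
  · push Not at hR
    have hc : R = 1 := by
      have := Fintype.card_eq_one_iff.mpr ⟨s, hR⟩
      rwa [Fintype.card_fin] at this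
    refine h1 hc ?_
    ext ⟨i, j⟩ r
    have := hg' i j
    rw [Finset.sum_eq_single s (fun r _ hr => absurd (hR r) hr) (by simp)] at this
    rw [hR r]
    exact (mul_eq_zero.mp this).resolve_right hs

/-! ### The reshaped kernel basis -/

theorem reshape_eq_cp {R l : ℕ} {w : Fin R → (Fin (2 + l) → Fin R) → ℝ}
    {F M : Matrix (Fin R) (Fin R) ℝ}
    (h : ∀ r k, w r k = ∑ s, khatriRaoPow F (2 + l) k s * M r s) :
    reshape w = cp F (khatriRaoPow F (1 + l)) M := by
  funext k κ r
  rw [reshape, h]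
  refine Finset.sum_congr rfl fun s _ => ?_
  congr 1
  have e := Equiv.prod_comp (finCongr (show 2 + l = (1 + l) + 1 by omega))
    fun q => F ((Fin.cons k κ : Fin ((1 + l) + 1) → Fin R) q) s
  rw [Fin.prod_univ_succ] at e
  simpa [khatriRaoPow] using e

/-- Any basis of the kernel reshapes to a tensor `[F, F ⊙ ⋯ ⊙ F, M]_R` with `M` nonsingular. -/
theorem exists_reshape_eq_cp {R l : ℕ} {w : Fin R → (Fin (2 + l) → Fin R) → ℝ}
    {C F : Matrix (Fin R) (Fin R) ℝ} (hF : Cᵀ * F = 1)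
    (h : Submodule.span ℝ (Set.range w) =
      Submodule.span ℝ (Set.range (khatriRaoPow F (2 + l)).col)) :
    ∃ M : Matrix (Fin R) (Fin R) ℝ, IsUnit M.det ∧
      reshape w = cp F (khatriRaoPow F (1 + l)) M := by
  have h1 : ∀ r, ∃ c : Fin R → ℝ, ∑ s, c s • (khatriRaoPow F (2 + l)).col s = w r := fun r =>
    (Submodule.mem_span_range_iff_exists_fun ℝ).mp (h ▸ Submodule.subset_span ⟨r, rfl⟩)
  have h2 : ∀ s, ∃ c : Fin R → ℝ, ∑ r, c r • w r = (khatriRaoPow F (2 + l)).col s := fun s =>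
    (Submodule.mem_span_range_iff_exists_fun ℝ).mp (h ▸ Submodule.subset_span ⟨s, rfl⟩)
  choose M hM using h1
  choose N hN using h2
  have hM' : ∀ r k, w r k = ∑ s, khatriRaoPow F (2 + l) k s * M r s := fun r k => by
    rw [← hM r, Finset.sum_apply]
    exact Finset.sum_congr rfl fun s _ => mul_comm _ _
  refine ⟨Matrix.of M, ?_, reshape_eq_cp hM'⟩
  let W : Matrix (Fin (2 + l) → Fin R) (Fin R) ℝ := Matrix.of fun k r => w r k
  have e1 : W = khatriRaoPow F (2 + l) * (Matrix.of M)ᵀ := by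
    ext k r
    exact hM' r k
  have e2 : khatriRaoPow F (2 + l) = W * (Matrix.of N)ᵀ := by
    ext k s
    have := (congrFun (hN s) k).symm
    rw [Finset.sum_apply] at this
    exact this.trans (Finset.sum_congr rfl fun r _ => mul_comm _ _)
  have hL := khatriRaoPow_leftInverse (n := 2 + l) (by omega) hF
  -- The two coordinate changes are mutually inverse once the left inverse of the Khatri-Rao power
  -- is cancelled.
  have e3 : (Matrix.of M)ᵀ * (Matrix.of N)ᵀ = 1 := by
    calc (Matrix.of M)ᵀ * (Matrix.of N)ᵀ
        = (khatriRaoPow C (2 + l))ᵀ * khatriRaoPow F (2 + l) *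
            ((Matrix.of M)ᵀ * (Matrix.of N)ᵀ) := by rw [hL, Matrix.one_mul]
      _ = 1 := by rw [Matrix.mul_assoc, ← Matrix.mul_assoc _ (Matrix.of M)ᵀ, ← e1, ← e2, hL]
  have e4 := Matrix.isUnit_det_of_right_inverse e3
  rwa [Matrix.det_transpose] at e4

/-! ### Slice pencils and generalized eigenvalues -/

theorem isUnit_det_of_rank_eq {R : ℕ} {C : Matrix (Fin R) (Fin R) ℝ} (h : C.rank = R) :
    IsUnit C.det := by
  rw [← Matrix.isUnit_iff_isUnit_det, ← Matrix.mulVec_surjective_iff_isUnit]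
  exact LinearMap.range_eq_top.mp (Submodule.eq_top_of_finrank_eq (by
    rw [Module.finrank_fin_fun]
    exact h) : LinearMap.range C.mulVecLin = ⊤)

theorem sliceComb_cp {ι κ : Type*} {R : ℕ} (F : Matrix ι (Fin R) ℝ) (K : Matrix κ (Fin R) ℝ)
    (M : Matrix (Fin R) (Fin R) ℝ) (x : Fin R → ℝ) :
    sliceComb (cp F K M) x = F * Matrix.diagonal (Mᵀ *ᵥ x) * Kᵀ := by
  ext i j
  rw [sliceComb, Matrix.of_apply, Matrix.mul_apply,
    Finset.sum_congr rfl fun r _ => mul_comm (x r) _, sum_cp_mul]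
  exact Finset.sum_congr rfl fun r _ => by
    rw [Matrix.mul_diagonal, Matrix.transpose_apply]
    ring

theorem rank_mul_diagonal_mul_transpose_eq_iff {κ : Type*} [Fintype κ] {R : ℕ}
    {F : Matrix (Fin R) (Fin R) ℝ} {K : Matrix κ (Fin R) ℝ} {L : Matrix (Fin R) κ ℝ}
    (hF : IsUnit F.det) (hL : L * K = 1) (η : Fin R → ℝ) :
    (F * Matrix.diagonal η * Kᵀ).rank = R ↔ ∀ s, η s ≠ 0 := by
  rw [Matrix.mul_assoc, Matrix.rank_mul_eq_right_of_isUnit_det _ _ hF]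
  have hle : (Matrix.diagonal η * Kᵀ).rank ≤ R := by
    simpa using (Matrix.diagonal η * Kᵀ).rank_le_card_height
  constructor
  · intro h s
    have h1 : (Matrix.diagonal η).rank = R := le_antisymm
      (by simpa using (Matrix.diagonal η).rank_le_card_height)
      (h.symm.le.trans (Matrix.rank_mul_le_left _ _))
    have := (isUnit_det_of_rank_eq h1).ne_zero
    rw [Matrix.det_diagonal, Finset.prod_ne_zero_iff] at this
    exact this s (Finset.mem_univ s)
  · intro h
    have hu : IsUnit (Matrix.diagonal η) := by
      rw [Matrix.isUnit_iff_isUnit_det, Matrix.det_diagonal, isUnit_iff_ne_zero,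
        Finset.prod_ne_zero_iff]
      exact fun s _ => h s
    have hKt : Kᵀ * Lᵀ = 1 := by rw [← Matrix.transpose_mul, hL, Matrix.transpose_one]
    have h1 := Matrix.rank_mul_le_left (Matrix.diagonal η * Kᵀ) Lᵀ
    rw [Matrix.mul_assoc, hKt, Matrix.mul_one, Matrix.rank_of_isUnit _ hu, Fintype.card_fin] at h1
    exact le_antisymm hle h1

theorem exists_isGEVD {κ : Type*} [Fintype κ] {R : ℕ} {F M : Matrix (Fin R) (Fin R) ℝ}
    {K : Matrix κ (Fin R) ℝ} {L : Matrix (Fin R) κ ℝ} (hF : IsUnit F.det) (hL : L * K = 1)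
    {x y : Fin R → ℝ} (hy : ∀ s, (Mᵀ *ᵥ y) s ≠ 0)
    (hxy : ∀ s t, s ≠ t → (Mᵀ *ᵥ x) s * (Mᵀ *ᵥ y) t - (Mᵀ *ᵥ x) t * (Mᵀ *ᵥ y) s ≠ 0) :
    ∃ (Z : Matrix (Fin R) (Fin R) ℝ) (d : Fin R → ℝ),
      IsGEVD (sliceComb (cp F K M) x) (sliceComb (cp F K M) y) Z d := by
  rw [sliceComb_cp, sliceComb_cp]
  -- Both slices have the form `F D Kᵀ`, so `F⁻¹` reduces them to `D Kᵀ`; the eigenvalues are the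
  -- ratios of the diagonal entries.
  refine ⟨(F⁻¹)ᵀ, fun s => (Mᵀ *ᵥ x) s / (Mᵀ *ᵥ y) s,
    (rank_mul_diagonal_mul_transpose_eq_iff hF hL _).mpr hy, ?_, ?_, ?_⟩
  · rw [Matrix.det_transpose]
    exact Matrix.isUnit_nonsing_inv_det _ hF
  · intro s t hst
    by_contra hne
    have := (div_eq_div_iff (hy s) (hy t)).mp hst
    exact hxy s t hne (sub_eq_zero.mpr this)
  · have h : ∀ D : Matrix (Fin R) (Fin R) ℝ, F⁻¹ * (F * D * Kᵀ) = D * Kᵀ := fun D => by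
      rw [Matrix.mul_assoc, ← Matrix.mul_assoc, Matrix.nonsing_inv_mul _ hF, Matrix.one_mul]
    rw [Matrix.transpose_transpose, h, h, ← Matrix.mul_assoc, Matrix.diagonal_mul_diagonal]
    congr 2
    funext s
    rw [div_mul_cancel₀ _ (hy s)]

/-- For generic combinations of the frontal slices a generalized eigenvalue decomposition exists. -/
theorem exists_polynomial_isGEVD {κ : Type*} [Fintype κ] {R : ℕ} {F M : Matrix (Fin R) (Fin R) ℝ}
    {K : Matrix κ (Fin R) ℝ} {L : Matrix (Fin R) κ ℝ} (hF : IsUnit F.det) (hM : IsUnit M.det)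
    (hL : L * K = 1) :
    ∃ f : MvPolynomial (Fin R ⊕ Fin R) ℝ, f ≠ 0 ∧
      ∀ x y : Fin R → ℝ, MvPolynomial.eval (Sum.elim x y) f ≠ 0 →
        ∃ (Z : Matrix (Fin R) (Fin R) ℝ) (d : Fin R → ℝ),
          IsGEVD (sliceComb (cp F K M) x) (sliceComb (cp F K M) y) Z d := by
  let ξ : Fin R → MvPolynomial (Fin R ⊕ Fin R) ℝ := fun s =>
    ∑ r, MvPolynomial.C (M r s) * MvPolynomial.X (Sum.inl r)
  let η : Fin R → MvPolynomial (Fin R ⊕ Fin R) ℝ := fun s =>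
    ∑ r, MvPolynomial.C (M r s) * MvPolynomial.X (Sum.inr r)
  -- The first product encodes full rank of `Q`, the second that the eigenvalue ratios are distinct.
  let f : MvPolynomial (Fin R ⊕ Fin R) ℝ :=
    (∏ s, η s) * ∏ s, ∏ t, if s = t then 1 else ξ s * η t - ξ t * η s
  have hξ : ∀ x y s, MvPolynomial.eval (Sum.elim x y) (ξ s) = (Mᵀ *ᵥ x) s := fun x y s => by
    simp [ξ, Matrix.mulVec, dotProduct]
  have hη : ∀ x y s, MvPolynomial.eval (Sum.elim x y) (η s) = (Mᵀ *ᵥ y) s := fun x y s => by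
    simp [η, Matrix.mulVec, dotProduct]
  have hf : ∀ x y, MvPolynomial.eval (Sum.elim x y) f ≠ 0 ↔ (∀ s, (Mᵀ *ᵥ y) s ≠ 0) ∧
      ∀ s t, s ≠ t → (Mᵀ *ᵥ x) s * (Mᵀ *ᵥ y) t - (Mᵀ *ᵥ x) t * (Mᵀ *ᵥ y) s ≠ 0 := by
    intro x y
    simp only [f, map_mul, map_prod, mul_ne_zero_iff, Finset.prod_ne_zero_iff, Finset.mem_univ,
      true_imp_iff, hη]
    refine and_congr_right fun _ => forall_congr' fun s => forall_congr' fun t => ?_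
    by_cases hst : s = t
    · simp [hst]
    · simp [hst, hξ, hη]
  refine ⟨f, ?_, fun x y h => exists_isGEVD hF hL ((hf x y).mp h).1 ((hf x y).mp h).2⟩
  have hMt : IsUnit (Mᵀ).det := by rwa [Matrix.det_transpose]
  have hinv : ∀ z : Fin R → ℝ, Mᵀ *ᵥ ((Mᵀ)⁻¹ *ᵥ z) = z := fun z => by
    rw [Matrix.mulVec_mulVec, Matrix.mul_nonsing_inv _ hMt, Matrix.one_mulVec]
  -- At this point the ratios are `0, …, R - 1` over denominators `1`, so `f` does not vanish.
  have h0 := (hf ((Mᵀ)⁻¹ *ᵥ fun s => (s.val : ℝ)) ((Mᵀ)⁻¹ *ᵥ fun _ => 1)).mpr (by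
    rw [hinv, hinv]
    refine ⟨fun _ => one_ne_zero, fun s t hst => ?_⟩
    simpa [sub_eq_zero, Fin.ext_iff] using hst)
  rintro hz
  exact h0 (by rw [hz, map_zero])

/-- A generalized eigenvalue decomposition recovers the first factor matrix up to permutation and
scaling of its columns. -/
theorem perm_scale_of_isGEVD {κ : Type*} [Fintype κ] {R : ℕ} {F M : Matrix (Fin R) (Fin R) ℝ}
    {K : Matrix κ (Fin R) ℝ} {L : Matrix (Fin R) κ ℝ} (hF : IsUnit F.det) (hL : L * K = 1)
    {x y : Fin R → ℝ} {Z : Matrix (Fin R) (Fin R) ℝ} {d : Fin R → ℝ}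
    (h : IsGEVD (sliceComb (cp F K M) x) (sliceComb (cp F K M) y) Z d) :
    ∃ (σ : Equiv.Perm (Fin R)) (δ : Fin R → ℝ), (∀ r, δ r ≠ 0) ∧
      ∀ i r, (Z⁻¹)ᵀ i r = δ r * F i (σ r) := by
  obtain ⟨hrank, hZ, hd, heq⟩ := h
  rw [sliceComb_cp] at heq hrank
  rw [sliceComb_cp] at heq
  have hη := (rank_mul_diagonal_mul_transpose_eq_iff hF hL _).mp hrank
  have hKt : Kᵀ * Lᵀ = 1 := by rw [← Matrix.transpose_mul, hL, Matrix.transpose_one]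
  have hE : Zᵀ * F * Matrix.diagonal (Mᵀ *ᵥ x) =
      Matrix.diagonal d * (Zᵀ * F * Matrix.diagonal (Mᵀ *ᵥ y)) := by
    have := congrArg (· * Lᵀ) heq
    simpa only [Matrix.mul_assoc, hKt, Matrix.mul_one] using this
  have hEu : IsUnit (Zᵀ * F).det := by
    rw [Matrix.det_mul, Matrix.det_transpose]
    exact hZ.mul hF
  have hFE : F = (Z⁻¹)ᵀ * (Zᵀ * F) := by
    rw [← Matrix.mul_assoc, ← Matrix.transpose_mul, Matrix.mul_nonsing_inv _ hZ,
      Matrix.transpose_one, Matrix.one_mul]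
  generalize Zᵀ * F = E at hE hEu hFE
  -- A nonzero entry `E r s` determines `d r` from `s` alone. As `d` is injective, no column of `E`
  -- has two nonzero entries.
  have he : ∀ r s, E r s ≠ 0 → d r = (Mᵀ *ᵥ x) s / (Mᵀ *ᵥ y) s := by
    intro r s hrs
    have := congrFun (congrFun hE r) s
    rw [Matrix.diagonal_mul, Matrix.mul_diagonal, Matrix.mul_diagonal] at this
    rw [eq_div_iff (hη s)]
    exact mul_left_cancel₀ hrs (by linear_combination -this)
  obtain ⟨τ, ε, hε, hτ⟩ := exists_perm_of_isUnit_det E hEu fun r s t hst => by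
    by_contra hne
    exact hst (hd ((he s r (left_ne_zero_of_mul hne)).trans
      (he t r (right_ne_zero_of_mul hne)).symm))
  refine ⟨τ.symm, fun r => (ε (τ.symm r))⁻¹, fun r => inv_ne_zero (hε _), fun i r => ?_⟩
  have := congrFun (congrFun hFE i) (τ.symm r)
  simp only [Matrix.mul_apply, hτ, Equiv.apply_symm_apply, mul_ite, mul_zero, Finset.sum_ite_eq',
    Finset.mem_univ, if_true] at this
  rw [this, mul_comm ((Z⁻¹)ᵀ i r), inv_mul_cancel_left₀ (hε _)]

/-! ### Recovering the decomposition of the original tensor -/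

theorem exists_cp_eq_of_perm_scale {R n : ℕ} {F F' M : Matrix (Fin R) (Fin R) ℝ}
    (hM : IsUnit M.det) (σ : Equiv.Perm (Fin R)) (δ : Fin R → ℝ) (hδ : ∀ r, δ r ≠ 0)
    (h : ∀ i r, F' i r = δ r * F i (σ r)) :
    ∃ M' : Matrix (Fin R) (Fin R) ℝ, IsUnit M'.det ∧
      cp F (khatriRaoPow F n) M = cp F' (khatriRaoPow F' n) M' := by
  -- The factor `F'` contributes one `δ r` and its Khatri-Rao power `n` more; the third factor
  -- absorbs them all.
  refine ⟨Matrix.of fun k r => ((δ r) ^ (n + 1))⁻¹ * M k (σ r),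
    isUnit_det_of_perm_scale hM σ (fun r => ((δ r) ^ (n + 1))⁻¹)
      (fun r => inv_ne_zero (pow_ne_zero _ (hδ r))) fun _ _ => rfl, ?_⟩
  funext i j k
  simp only [cp]
  rw [← Equiv.sum_comp σ]
  refine Finset.sum_congr rfl fun r _ => ?_
  simp only [khatriRaoPow, Matrix.of_apply, h, Finset.prod_mul_distrib, Finset.prod_const,
    Finset.card_univ, Fintype.card_fin]
  have := hδ r
  field_simp
  ring

theorem rank_eq_one_of_outer {I J : ℕ} {X : Matrix (Fin I) (Fin J) ℝ} {u : Fin I → ℝ}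
    {v : Fin J → ℝ} (h : X = Matrix.vecMulVec u v) (hu : u ≠ 0) (hv : v ≠ 0) : X.rank = 1 := by
  refine le_antisymm (h ▸ Matrix.rank_vecMulVec_le u v) (Nat.one_le_iff_ne_zero.mpr fun h0 => ?_)
  rw [Matrix.rank, Submodule.finrank_eq_zero, LinearMap.range_eq_bot] at h0
  replace h0 : X = 0 := Matrix.toLin'.injective (h0.trans (map_zero _).symm)
  obtain ⟨i, hi⟩ := Function.ne_iff.mp hu
  obtain ⟨j, hj⟩ := Function.ne_iff.mp hv
  have := congrFun (congrFun (h.symm.trans h0) i) j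
  rw [Matrix.vecMulVec_apply] at this
  exact mul_ne_zero hi hj this

/-- Contracting the third mode with a permuted and rescaled dual basis isolates the terms. -/
theorem unfold_cp_mul_perm_scale {ι κ : Type*} {R : ℕ} {A : Matrix ι (Fin R) ℝ}
    {B : Matrix κ (Fin R) ℝ} {C F F' : Matrix (Fin R) (Fin R) ℝ} (hF : Cᵀ * F = 1)
    {σ : Equiv.Perm (Fin R)} {δ : Fin R → ℝ} (h : ∀ i r, F' i r = δ r * F i (σ r)) (i : ι) (j : κ)
    (r : Fin R) : (unfold (cp A B C) * F') (i, j) r = δ r * A i (σ r) * B j (σ r) := by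
  have hCF : ∀ s, ∑ k, C k s * F' k r = δ r * (1 : Matrix (Fin R) (Fin R) ℝ) s (σ r) := by
    intro s
    rw [← hF, Matrix.mul_apply, Finset.mul_sum]
    exact Finset.sum_congr rfl fun k _ => by
      rw [h, Matrix.transpose_apply]
      ring
  rw [unfold_cp, Matrix.mul_assoc, Matrix.mul_apply]
  simp only [Matrix.mul_apply, Matrix.transpose_apply, hCF, khatriRao, Matrix.of_apply]
  simp [Matrix.one_apply]
  ring

theorem eq_cp_of_khatriRao_eq {ι κ : Type*} {R : ℕ} {T : ι → κ → Fin R → ℝ}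
    {F : Matrix (Fin R) (Fin R) ℝ} (hF : IsUnit F.det) {A : Matrix ι (Fin R) ℝ}
    {B : Matrix κ (Fin R) ℝ} (h : khatriRao A B = unfold T * F) : T = cp A B (F⁻¹)ᵀ := by
  apply unfold_injective
  rw [unfold_cp, Matrix.transpose_transpose, h, Matrix.mul_assoc, Matrix.mul_nonsing_inv _ hF,
    Matrix.mul_one]

end CPD

theorem mainTheorem2 (I J R l : ℕ) (T : Fin I → Fin J → Fin R → ℝ)
    (A : Matrix (Fin I) (Fin R) ℝ) (B : Matrix (Fin J) (Fin R) ℝ) (C : Matrix (Fin R) (Fin R) ℝ)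
    (hT : T = CPD.cp A B C)
    (hT1 : R = 1 → T ≠ 0)
    (hC : C.rank = R)
    (hdim : Module.finrank ℝ (CPD.symKer l T) = R) :
    -- (1) rank and uniqueness
    (CPD.HasTensorRank T R ∧ CPD.UniqueCPD T R) ∧
    -- (2) the algorithm: the null space has a basis `w`, and whichever basis has been computed ...
    (∃ w : Fin R → (Fin (2 + l) → Fin R) → ℝ, CPD.IsNullBasis l T w) ∧
    ∀ w : Fin R → (Fin (2 + l) → Fin R) → ℝ, CPD.IsNullBasis l T w →
      -- the reshaped tensor has rank `R` and a unique CPD;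
      (CPD.HasTensorRank (CPD.reshape w) R ∧ CPD.UniqueCPD (CPD.reshape w) R) ∧
      -- the pencil of two generic combinations of its frontal slices has a GEVD;
      (∃ f : MvPolynomial (Fin R ⊕ Fin R) ℝ, f ≠ 0 ∧
        ∀ x y : Fin R → ℝ, MvPolynomial.eval (Sum.elim x y) f ≠ 0 →
          ∃ (Z : Matrix (Fin R) (Fin R) ℝ) (d : Fin R → ℝ),
            CPD.IsGEVD (CPD.sliceComb (CPD.reshape w) x) (CPD.sliceComb (CPD.reshape w) y) Z d) ∧
      -- every such GEVD delivers the CPD `[F, F ⊙ ⋯ ⊙ F, M]_R` of the reshaped tensor, `F = Z^{-T}`;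
      (∀ (x y : Fin R → ℝ) (Z : Matrix (Fin R) (Fin R) ℝ) (d : Fin R → ℝ),
        CPD.IsGEVD (CPD.sliceComb (CPD.reshape w) x) (CPD.sliceComb (CPD.reshape w) y) Z d →
        ∃ M : Matrix (Fin R) (Fin R) ℝ, IsUnit M.det ∧
          CPD.IsCPD (CPD.reshape w) (Z⁻¹).transpose
            (CPD.khatriRaoPow (Z⁻¹).transpose (1 + l)) M) ∧
      -- and every CPD of that form delivers the CPD of `T`, with third factor matrix `F^{-T}`
      ∀ F M : Matrix (Fin R) (Fin R) ℝ,
        CPD.IsCPD (CPD.reshape w) F (CPD.khatriRaoPow F (1 + l)) M →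
        IsUnit F.det ∧
        (∀ r, (Matrix.of fun (i : Fin I) (j : Fin J) => (CPD.unfold T * F) (i, j) r).rank = 1) ∧
        (∃ (A' : Matrix (Fin I) (Fin R) ℝ) (B' : Matrix (Fin J) (Fin R) ℝ),
          CPD.khatriRao A' B' = CPD.unfold T * F) ∧
        ∀ (A' : Matrix (Fin I) (Fin R) ℝ) (B' : Matrix (Fin J) (Fin R) ℝ),
          CPD.khatriRao A' B' = CPD.unfold T * F →
          CPD.IsCPD T A' B' (F⁻¹).transpose := by
  subst hT
  have hCu := CPD.isUnit_det_of_rank_eq hC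
  have hCt : IsUnit (C.transpose).det := by rwa [Matrix.det_transpose]
  have hCF : C.transpose * (C.transpose)⁻¹ = 1 := Matrix.mul_nonsing_inv _ hCt
  have hF : IsUnit ((C.transpose)⁻¹).det := Matrix.isUnit_nonsing_inv_det _ hCt
  generalize (C.transpose)⁻¹ = F at hCF hF
  have hone := CPD.onlyTrivialRankOne_of_finrank_symKer hCF hdim
  have hinj := CPD.khatriRao_injective_of_onlyTrivialRankOne hone fun hR h0 => hT1 hR <|
    CPD.unfold_injective (T' := 0) <| by
      rw [CPD.unfold_cp, h0, Matrix.zero_mul]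
      rfl
  have hspan := CPD.symKer_cp_eq_span hCF hdim
  have hL := CPD.khatriRaoPow_leftInverse (n := 1 + l) (by omega) hCF
  have hrank := CPD.hasTensorRank_cp hCu hinj
  refine ⟨⟨hrank, CPD.uniqueCPD_cp hCu hinj hone⟩,
    ⟨(CPD.khatriRaoPow F (2 + l)).col, CPD.linearIndependent_col_of_leftInverse
      (CPD.khatriRaoPow_leftInverse (by omega) hCF), hspan⟩, fun w hw => ?_⟩
  obtain ⟨M, hM, hW⟩ := CPD.exists_reshape_eq_cp hCF (hw.2.trans hspan.symm)
  rw [hW]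
  have hFK := CPD.khatriRao_injective_of_leftInverse hCF hL
  have honeW := CPD.onlyTrivialRankOne_of_leftInverse hCF hL
  have hrankW := CPD.hasTensorRank_cp hM hFK
  have huniqW := CPD.uniqueCPD_cp hM hFK honeW
  refine ⟨⟨hrankW, huniqW⟩, CPD.exists_polynomial_isGEVD hF hM hL, fun x y Z d hZ => ?_,
    fun F' M' hF' => ?_⟩
  · obtain ⟨σ, δ, hδ, hσ⟩ := CPD.perm_scale_of_isGEVD hF hL hZ
    obtain ⟨M', hM', h⟩ := CPD.exists_cp_eq_of_perm_scale (n := 1 + l) hM σ δ hδ hσ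
    exact ⟨M', hM', h, hrankW⟩
  · obtain ⟨σ, α, β, γ, hαβγ, hα, -, -⟩ := huniqW _ _ _ _ _ _ ⟨rfl, hrankW⟩ hF'
    have hα0 : ∀ r, α r ≠ 0 := fun r h0 => by simpa [h0] using hαβγ r
    have hFu := CPD.isUnit_det_of_perm_scale hF σ α hα0 hα
    have hterm := CPD.unfold_cp_mul_perm_scale (A := A) (B := B) hCF hα
    refine ⟨hFu, fun r => ?_, ⟨Matrix.of fun i r => α r * A i (σ r), Matrix.of fun j r => B j (σ r),
      ?_⟩, fun A' B' h => ⟨CPD.eq_cp_of_khatriRao_eq hFu h, hrank⟩⟩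
    · have hne := CPD.khatriRao_col_ne_zero hinj (σ r)
      exact CPD.rank_eq_one_of_outer (u := α r • A.col (σ r)) (v := B.col (σ r))
        (Matrix.ext fun i j => hterm i j r) (smul_ne_zero (hα0 r) hne.1) hne.2
    · ext ⟨i, j⟩ r
      exact (hterm i j r).symm
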